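/- Conventions. A topological groupoid is a groupoid $G$ with unit space $G^{(0)}\subseteq G$ and range and source maps $r,s:G\to G^{(0)}$, carrying a topology such that the set $G^{(2)}=\{(\alpha,\beta): s(\alpha)=r(\beta)\}$ of composable pairs is closed in $G\times G$ and composition $G^{(2)}\to G$ and inversion are continuous. It is étale if $r,s:G\to G$ are local homeomorphisms. An open bisection is an open set $E\subseteq G$ such that $r(E),s(E)$ are open in $G$ and $r|_E,s|_E$ are homeomorphisms onto $r(E)$, $s(E)$; $G$ is ample if its topology has a basis of compact open bisections. For a Hausdorff étale ample groupoid $G$, let $C_c(G^{(0)},\mathbb{Z})^+$ be the monoid of non-negative, compactly supported, continuous functions $G^{(0)}\to\mathbb{Z}$. For $f,g\in C_c(G^{(0)},\mathbb{Z})^+$ write $f\sim_G g$ if there are finitely many compact open bisections $E_1,\dots,E_n$ of $G$ with $f=\sum_{i=1}^n 1_{s(E_i)}$ and $g=\sum_{i=1}^n 1_{r(E_i)}$. This is an equivalence relation compatible with addition; the type semigroup is the abelian monoid $S(G):=C_c(G^{(0)},\mathbb{Z})^+/\sim_G$ with $[f]+[g]=[f+g]$. Groupoids $G$ and $H$ are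 equivalent if there is a locally compact Hausdorff space $Z$ with continuous, free and proper actions of $G$ on the left and of $H$ on the right, with continuous open moment maps $\rho:Z\to G^{(0)}$ and $\sigma:Z\to H^{(0)}$, such that the two actions commute, $\rho$ induces a bijection $Z/H\to G^{(0)}$, and $\sigma$ induces a bijection $G\backslash Z\to H^{(0)}$. (The left action is free if $g\cdot z=z$ only for units $g$, and proper if $(g,z)\mapsto(g\cdot z,z)$, defined on $\{(g,z): s(g)=\rho(z)\}$, is a proper map into $Z\times Z$; similarly on the right.) Corollary. Let $G$ and $H$ be locally compact Hausdorff étale ample groupoids with $\sigma$-compact unit spaces. If $G$ and $H$ are equivalent, then $S(G)$ and $S(H)$ are isomorphic as abelian monoids. -/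

import Mathlib

open Set
open scoped CompactlySupported

universe u v w

namespace AmpleGpd

/-! ### Groupoids -/

/-- A groupoid, presented by its set of arrows `G`: a set of units, range and source maps with
values in the units, a product `mul a b` defined exactly when `s a = r b`, and inverses. -/
class ArrowGroupoid (G : Type u) where
  /-- the unit space, as a subset of the groupoid -/
  units : Set G
  /-- range map -/
  r : G → G
  /-- source map -/
  s : G → G
  r_mem : ∀ a, r a ∈ units
  s_mem : ∀ a, s a ∈ units
  r_unit : ∀ x ∈ units, r x = x
  s_unit : ∀ x ∈ units, s x = x
  /-- the product of a composable pair -/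
  mul : (a b : G) → s a = r b → G
  r_mul : ∀ (a b : G) (h : s a = r b), r (mul a b h) = r a
  s_mul : ∀ (a b : G) (h : s a = r b), s (mul a b h) = s b
  mul_assoc : ∀ (a b c : G) (h : s a = r b) (k : s b = r c),
    mul (mul a b h) c ((s_mul a b h).trans k) = mul a (mul b c k) (h.trans (r_mul b c k).symm)
  r_mul_self : ∀ a : G, mul (r a) a (s_unit _ (r_mem a)) = a
  mul_s_self : ∀ a : G, mul a (s a) (r_unit _ (s_mem a)).symm = a
  /-- inversion -/
  inv : G → G
  r_inv : ∀ a, r (inv a) = s a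
  s_inv : ∀ a, s (inv a) = r a
  mul_inv : ∀ a : G, mul a (inv a) (r_inv a).symm = r a
  inv_mul : ∀ a : G, mul (inv a) a (s_inv a) = s a

open ArrowGroupoid

/-- The unit space `G⁽⁰⁾` as a type (with the subspace topology when `G` has a topology). -/
abbrev UnitSpace (G : Type u) [ArrowGroupoid G] : Type u := (units : Set G)

/-- A topological groupoid: the set of composable pairs is closed, and multiplication (on the set of
composable pairs, with the topology inherited from `G × G`) and inversion are continuous. -/
class IsTopologicalGroupoid (G : Type u) [ArrowGroupoid G] [TopologicalSpace G] : Prop where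
  isClosed_composable : IsClosed {p : G × G | s p.1 = r p.2}
  continuous_mul : Continuous fun p : {p : G × G // s p.1 = r p.2} => mul p.1.1 p.1.2 p.2
  continuous_inv : Continuous (inv : G → G)

/-- A groupoid is étale if `r, s : G → G` are local homeomorphisms. -/
class IsEtale (G : Type u) [ArrowGroupoid G] [TopologicalSpace G] : Prop where
  isLocalHomeomorph_r : IsLocalHomeomorph (r : G → G)
  isLocalHomeomorph_s : IsLocalHomeomorph (s : G → G)

/-- An open bisection: an open set `E` such that `r(E)` and `s(E)` are open in `G` and `r`, `s`
restrict to homeomorphisms of `E` onto `r(E)` and `s(E)`. -/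
structure IsOpenBisection {G : Type u} [ArrowGroupoid G] [TopologicalSpace G] (E : Set G) :
    Prop where
  isOpen : IsOpen E
  isOpenEmbedding_r : Topology.IsOpenEmbedding (E.domRestrict (r : G → G))
  isOpenEmbedding_s : Topology.IsOpenEmbedding (E.domRestrict (s : G → G))

/-- A compact open bisection. -/
structure IsCompactOpenBisection {G : Type u} [ArrowGroupoid G] [TopologicalSpace G] (E : Set G) :
    Prop extends IsOpenBisection E where
  isCompact : IsCompact E

/-- A groupoid is ample if its topology has a basis of compact open bisections. -/
class IsAmple (G : Type u) [ArrowGroupoid G] [TopologicalSpace G] : Prop where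
  isTopologicalBasis :
    TopologicalSpace.IsTopologicalBasis {E : Set G | IsCompactOpenBisection E}

/-! ### The relation defining the type semigroup -/

/-- The positive cone `C_c(G⁽⁰⁾, ℤ)⁺`. -/
abbrev PosCone (G : Type u) [ArrowGroupoid G] [TopologicalSpace G] : Type u :=
  AddSubmonoid.nonneg C_c(UnitSpace G, ℤ)

/-- `f ∼ g` if there are finitely many compact open bisections `E₁, …, Eₙ` with
`f = ∑ 1_{s(Eᵢ)}` and `g = ∑ 1_{r(Eᵢ)}`. -/
def TypeRel (G : Type u) [ArrowGroupoid G] [TopologicalSpace G] (f g : PosCone G) : Prop :=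
  ∃ (n : ℕ) (E : Fin n → Set G), (∀ i, IsCompactOpenBisection (E i)) ∧
    (∀ x : UnitSpace G, f.1 x = ∑ i, (s '' E i).indicator (fun _ => (1 : ℤ)) (x : G)) ∧
    (∀ x : UnitSpace G, g.1 x = ∑ i, (r '' E i).indicator (fun _ => (1 : ℤ)) (x : G))

/-! ### The relation is an additive congruence -/

section Congruence

variable {G : Type u} [ArrowGroupoid G]

lemma mul_congr {a b c d : G} (h : s a = r b) (k : s c = r d) (hac : a = c) (hbd : b = d) :
    mul a b h = mul c d k := by
  subst hac hbd; rfl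

lemma mul_inv_cancel_right (a b : G) (h : s a = r b) :
    mul (mul a b h) (inv b) ((s_mul a b h).trans (r_inv b).symm) = a := by
  rw [mul_assoc a b (inv b) h (r_inv b).symm]
  exact (mul_congr _ (r_unit _ (s_mem a)).symm rfl ((mul_inv b).trans h.symm)).trans (mul_s_self a)

lemma mul_inv_mul_cancel (c b : G) (h : s c = s b) :
    mul (mul c (inv b) (h.trans (r_inv b).symm)) b ((s_mul _ _ _).trans (s_inv b)) = c := by
  rw [mul_assoc c (inv b) b (h.trans (r_inv b).symm) (s_inv b)]
  exact (mul_congr _ (r_unit _ (s_mem c)).symm rfl ((inv_mul b).trans h.symm)).trans (mul_s_self c)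

lemma inv_inv (a : G) : inv (inv a) = a := by
  have h1 := mul_inv_mul_cancel (inv (inv a)) a ((s_inv _).trans (r_inv a))
  have h2 : mul (inv (inv a)) (inv a) (s_inv _) = r a := (inv_mul (inv a)).trans (s_inv a)
  rw [← h1]
  exact (mul_congr _ (s_unit _ (r_mem a)) h2 rfl).trans (r_mul_self a)

variable [TopologicalSpace G]

lemma continuous_r [IsEtale G] : Continuous (r : G → G) :=
  (IsEtale.isLocalHomeomorph_r (G := G)).continuous

lemma continuous_s [IsEtale G] : Continuous (s : G → G) :=
  (IsEtale.isLocalHomeomorph_s (G := G)).continuous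

lemma isOpen_units [IsEtale G] : IsOpen (units : Set G) := by
  have h : (units : Set G) = range (r : G → G) := by
    ext x
    exact ⟨fun hx => ⟨x, r_unit x hx⟩, fun ⟨a, ha⟩ => ha ▸ r_mem a⟩
  rw [h]
  exact (IsEtale.isLocalHomeomorph_r (G := G)).isOpenMap.isOpen_range

lemma isCompactOpenBisection_of_injOn [IsEtale G] {E : Set G} (hc : IsCompact E) (ho : IsOpen E)
    (hr : InjOn (r : G → G) E) (hs : InjOn (s : G → G) E) : IsCompactOpenBisection E where
  isOpen := ho
  isCompact := hc
  isOpenEmbedding_r := .of_continuous_injective_isOpenMap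
    (continuous_r.comp continuous_subtype_val) (injOn_iff_injective.1 hr)
    ((IsEtale.isLocalHomeomorph_r (G := G)).isOpenMap.comp ho.isOpenMap_subtype_val)
  isOpenEmbedding_s := .of_continuous_injective_isOpenMap
    (continuous_s.comp continuous_subtype_val) (injOn_iff_injective.1 hs)
    ((IsEtale.isLocalHomeomorph_s (G := G)).isOpenMap.comp ho.isOpenMap_subtype_val)

lemma IsOpenBisection.injOn_r {E : Set G} (hE : IsOpenBisection E) : InjOn (r : G → G) E :=
  injOn_iff_injective.2 hE.isOpenEmbedding_r.injective

lemma IsOpenBisection.injOn_s {E : Set G} (hE : IsOpenBisection E) : InjOn (s : G → G) E :=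
  injOn_iff_injective.2 hE.isOpenEmbedding_s.injective

lemma IsOpenBisection.isOpen_r {E : Set G} (hE : IsOpenBisection E) : IsOpen (r '' E) := by
  have := hE.isOpenEmbedding_r.isOpen_range
  rwa [range_domRestrict] at this

lemma IsOpenBisection.isOpen_s {E : Set G} (hE : IsOpenBisection E) : IsOpen (s '' E) := by
  have := hE.isOpenEmbedding_s.isOpen_range
  rwa [range_domRestrict] at this

/-- A compact open subset of the unit space is a compact open bisection. -/
lemma isCompactOpenBisection_units [IsEtale G] {A : Set (UnitSpace G)} (hc : IsCompact A)
    (ho : IsOpen A) : IsCompactOpenBisection (Subtype.val '' A : Set G) := by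
  apply isCompactOpenBisection_of_injOn (hc.image continuous_subtype_val)
    (isOpen_units.isOpenMap_subtype_val _ ho)
  · rintro _ ⟨x, -, rfl⟩ _ ⟨y, -, rfl⟩ h
    rwa [r_unit _ x.2, r_unit _ y.2] at h
  · rintro _ ⟨x, -, rfl⟩ _ ⟨y, -, rfl⟩ h
    rwa [s_unit _ x.2, s_unit _ y.2] at h

/-- The product of two subsets of a groupoid. -/
def setMul (F E : Set G) : Set G := {c | ∃ b ∈ F, ∃ a ∈ E, ∃ h : s b = r a, mul b a h = c}

lemma isCompactOpenBisection_inv [IsTopologicalGroupoid G] [IsEtale G] {E : Set G}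
    (hE : IsCompactOpenBisection E) : IsCompactOpenBisection (inv '' E) := by
  have hinv : (inv '' E : Set G) = inv ⁻¹' E := by
    ext x
    constructor
    · rintro ⟨a, ha, rfl⟩
      rwa [mem_preimage, inv_inv]
    · intro hx
      exact ⟨inv x, hx, inv_inv x⟩
  have hci : Continuous (inv : G → G) := IsTopologicalGroupoid.continuous_inv
  apply isCompactOpenBisection_of_injOn (hE.isCompact.image hci)
    (by rw [hinv]; exact hE.isOpen.preimage hci)
  · rintro _ ⟨x, hx, rfl⟩ _ ⟨y, hy, rfl⟩ h
    rw [r_inv, r_inv] at h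
    rw [hE.injOn_s hx hy h]
  · rintro _ ⟨x, hx, rfl⟩ _ ⟨y, hy, rfl⟩ h
    rw [s_inv, s_inv] at h
    rw [hE.injOn_r hx hy h]

lemma isCompactOpenBisection_mul [IsTopologicalGroupoid G] [IsEtale G] {F E : Set G}
    (hF : IsCompactOpenBisection F) (hE : IsCompactOpenBisection E) :
    IsCompactOpenBisection (setMul F E) := by
  have hcm := IsTopologicalGroupoid.continuous_mul (G := G)
  have hci : Continuous (inv : G → G) := IsTopologicalGroupoid.continuous_inv
  apply isCompactOpenBisection_of_injOn
  · have h1 : IsCompact ((Subtype.val : {p : G × G // s p.1 = r p.2} → G × G) ⁻¹' (F ×ˢ E)) :=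
      (IsTopologicalGroupoid.isClosed_composable (G := G)).isClosedEmbedding_subtypeVal
        |>.isCompact_preimage (hF.isCompact.prod hE.isCompact)
    convert h1.image hcm using 1
    ext c
    constructor
    · rintro ⟨b, hb, a, ha, h, rfl⟩
      exact ⟨⟨(b, a), h⟩, ⟨hb, ha⟩, rfl⟩
    · rintro ⟨⟨⟨b, a⟩, h⟩, ⟨hb, ha⟩, rfl⟩
      exact ⟨b, hb, a, ha, h, rfl⟩
  · have he := hE.isOpenEmbedding_s
    set U : Set G := s ⁻¹' (range (E.domRestrict (s : G → G))) with hU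
    have hUo : IsOpen U := he.isOpen_range.preimage continuous_s
    let e := he.isEmbedding.toHomeomorph
    let al : U → E := fun c => e.symm ⟨s c.1, c.2⟩
    have hal : Continuous al :=
      e.symm.continuous.comp ((continuous_s.comp continuous_subtype_val).subtype_mk _)
    have hals : ∀ c : U, s (al c).1 = s c.1 := fun c =>
      congrArg Subtype.val (e.apply_symm_apply ⟨s c.1, c.2⟩)
    let phi : U → G := fun c => mul c.1 (inv (al c).1) ((hals c).symm.trans (r_inv _).symm)
    have hphi : Continuous phi :=
      hcm.comp (Continuous.subtype_mk (continuous_subtype_val.prodMk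
        (hci.comp (continuous_subtype_val.comp hal)))
        (fun c => (hals c).symm.trans (r_inv _).symm))
    have hB : setMul F E = Subtype.val '' (phi ⁻¹' F) := by
      ext c
      constructor
      · rintro ⟨b, hb, a, ha, h, rfl⟩
        have hm : mul b a h ∈ U := ⟨⟨a, ha⟩, (s_mul b a h).symm⟩
        refine ⟨⟨mul b a h, hm⟩, ?_, rfl⟩
        have h1 : (al ⟨_, hm⟩).1 = a :=
          hE.injOn_s (al ⟨_, hm⟩).2 ha ((hals ⟨_, hm⟩).trans (s_mul b a h))
        have h2 : phi ⟨_, hm⟩ = b :=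
          (mul_congr _ _ rfl (congrArg inv h1)).trans (mul_inv_cancel_right b a h)
        rw [mem_preimage, h2]
        exact hb
      · rintro ⟨c, hc, rfl⟩
        exact ⟨phi c, hc, (al c).1, (al c).2, _, mul_inv_mul_cancel c.1 (al c).1 (hals c).symm⟩
    rw [hB]
    exact hUo.isOpenMap_subtype_val _ (hF.isOpen.preimage hphi)
  · rintro _ ⟨b, hb, a, ha, h, rfl⟩ _ ⟨b', hb', a', ha', h', rfl⟩ hh
    rw [r_mul, r_mul] at hh
    have hbb := hF.injOn_r hb hb' hh
    subst hbb
    exact mul_congr _ _ rfl (hE.injOn_r ha ha' (h.symm.trans h'))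
  · rintro _ ⟨b, hb, a, ha, h, rfl⟩ _ ⟨b', hb', a', ha', h', rfl⟩ hh
    rw [s_mul, s_mul] at hh
    have haa := hE.injOn_s ha ha' hh
    subst haa
    exact mul_congr _ _ (hF.injOn_s hb hb' (h.trans h'.symm)) rfl

/-- The relation may be witnessed by families indexed by any finite type. -/
lemma typeRel_of_fintype {ι : Type*} [Fintype ι] {f g : PosCone G} (E : ι → Set G)
    (hE : ∀ i, IsCompactOpenBisection (E i))
    (hf : ∀ x : UnitSpace G, f.1 x = ∑ i, (s '' E i).indicator (fun _ => (1 : ℤ)) (x : G))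
    (hg : ∀ x : UnitSpace G, g.1 x = ∑ i, (r '' E i).indicator (fun _ => (1 : ℤ)) (x : G)) :
    TypeRel G f g := by
  let e := (Fintype.equivFin ι).symm
  refine ⟨Fintype.card ι, E ∘ e, fun i => hE _, fun x => ?_, fun x => ?_⟩
  · rw [hf x]
    exact (e.sum_comp fun i => (s '' E i).indicator (fun _ => (1 : ℤ)) (x : G)).symm
  · rw [hg x]
    exact (e.sum_comp fun i => (r '' E i).indicator (fun _ => (1 : ℤ)) (x : G)).symm

lemma typeRel_refl [IsEtale G] (f : PosCone G) : TypeRel G f f := by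
  obtain ⟨C, hC⟩ := f.1.hasCompactSupport'.exists_bound_of_continuous f.1.continuous
  obtain ⟨N, hN⟩ := exists_nat_ge C
  have hfN : ∀ x, f.1 x ≤ N := by
    intro x
    have h1 : (|f.1 x| : ℝ) ≤ N := by
      have := (hC x).trans hN
      rwa [Int.norm_eq_abs] at this
    have h2 : |f.1 x| ≤ (N : ℤ) := by exact_mod_cast h1
    exact (le_abs_self _).trans h2
  have hf0 : ∀ x, 0 ≤ f.1 x := fun x => f.2 x
  let A : Fin N → Set (UnitSpace G) := fun i => f.1 ⁻¹' Ici ((i : ℤ) + 1)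
  have hAc : ∀ i, IsClosed (A i) := fun i => (isClosed_discrete _).preimage f.1.continuous
  have hA : ∀ i, IsCompact (A i) := fun i =>
    f.1.hasCompactSupport'.isCompact.of_isClosed_subset (hAc i) fun x hx =>
      subset_tsupport _ (by
        have : (i : ℤ) + 1 ≤ f.1 x := hx
        change f.1 x ≠ 0
        omega)
  have hAo : ∀ i, IsOpen (A i) := fun i => (isOpen_discrete _).preimage f.1.continuous
  have hsum : ∀ x : UnitSpace G, f.1 x
      = ∑ i : Fin N, (Subtype.val '' A i : Set G).indicator (fun _ => (1 : ℤ)) (x : G) := by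
    intro x
    have h1 : ∀ i : Fin N, (Subtype.val '' A i : Set G).indicator (fun _ => (1 : ℤ)) (x : G)
        = if (i : ℕ) < (f.1 x).toNat then 1 else 0 := by
      intro i
      have h2 : ((x : G) ∈ (Subtype.val '' A i : Set G)) ↔ (i : ℕ) < (f.1 x).toNat := by
        rw [Subtype.val_injective.mem_set_image]
        change (i : ℤ) + 1 ≤ f.1 x ↔ _
        omega
      by_cases hi : (i : ℕ) < (f.1 x).toNat
      · rw [if_pos hi, indicator_of_mem (h2.2 hi)]
      · rw [if_neg hi, indicator_of_notMem (mt h2.1 hi)]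
    simp only [h1]
    rw [Fin.sum_univ_eq_sum_range (fun k => if k < (f.1 x).toNat then (1 : ℤ) else 0) N,
      ← Finset.sum_filter, Finset.sum_const]
    have h3 : Finset.filter (fun k => k < (f.1 x).toNat) (Finset.range N)
        = Finset.range (f.1 x).toNat := by
      ext k
      simp only [Finset.mem_filter, Finset.mem_range]
      have := hfN x
      omega
    rw [h3]
    simp [hf0 x]
  have himg : ∀ (t : G → G), (∀ y ∈ (units : Set G), t y = y) → ∀ i,
      t '' (Subtype.val '' A i) = (Subtype.val '' A i : Set G) := by
    intro t ht i
    refine (image_congr ?_).trans (image_id _)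
    rintro _ ⟨y, -, rfl⟩
    exact ht _ y.2
  refine ⟨N, fun i => Subtype.val '' A i, fun i => isCompactOpenBisection_units (hA i) (hAo i),
    fun x => ?_, fun x => ?_⟩
  · simp only [himg s s_unit, hsum x]
  · simp only [himg r r_unit, hsum x]

lemma typeRel_symm [IsTopologicalGroupoid G] [IsEtale G] {f g : PosCone G}
    (h : TypeRel G f g) : TypeRel G g f := by
  obtain ⟨n, E, hE, hf, hg⟩ := h
  refine ⟨n, fun i => inv '' E i, fun i => isCompactOpenBisection_inv (hE i), ?_, ?_⟩
  · simpa only [image_image, s_inv] using hg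
  · simpa only [image_image, r_inv] using hf

lemma typeRel_add {f f' g g' : PosCone G} (h : TypeRel G f f')
    (k : TypeRel G g g') : TypeRel G (f + g) (f' + g') := by
  obtain ⟨m, E, hE, hf, hf'⟩ := h
  obtain ⟨n, F, hF, hg, hg'⟩ := k
  refine typeRel_of_fintype (ι := Fin m ⊕ Fin n) (Sum.elim E F) ?_ ?_ ?_
  · rintro (i | i)
    exacts [hE i, hF i]
  · intro x
    rw [Fintype.sum_sum_type]
    exact congrArg₂ (· + ·) (hf x) (hg x)
  · intro x
    rw [Fintype.sum_sum_type]
    exact congrArg₂ (· + ·) (hf' x) (hg' x)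

/-- Refinement: two finite families of clopen sets with `∑ 1_{Aᵢ} = ∑ 1_{Bⱼ}` have a common
refinement by clopen sets. -/
lemma exists_refinement {X : Type*} [TopologicalSpace X] {m n : ℕ} (A : Fin m → Set X)
    (B : Fin n → Set X) (hA : ∀ i, IsClopen (A i)) (hB : ∀ j, IsClopen (B j))
    (h : ∀ x, ∑ i, (A i).indicator (fun _ => (1 : ℤ)) x
      = ∑ j, (B j).indicator (fun _ => (1 : ℤ)) x) :
    ∃ Z : Fin m → Fin n → Set X, (∀ i j, IsClopen (Z i j)) ∧
      (∀ i x, (A i).indicator (fun _ => (1 : ℤ)) x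
        = ∑ j, (Z i j).indicator (fun _ => (1 : ℤ)) x) ∧
      (∀ j x, (B j).indicator (fun _ => (1 : ℤ)) x
        = ∑ i, (Z i j).indicator (fun _ => (1 : ℤ)) x) := by
  classical
  -- for finite sets `I`, `J` of equal cardinality, choose a perfect matching
  have hM : ∀ p : Finset (Fin m) × Finset (Fin n), ∃ M : Fin m → Fin n → Prop,
      p.1.card = p.2.card →
        (∀ i, (if i ∈ p.1 then (1 : ℤ) else 0) = ∑ j, if M i j then 1 else 0) ∧
        (∀ j, (if j ∈ p.2 then (1 : ℤ) else 0) = ∑ i, if M i j then 1 else 0) := by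
    rintro ⟨I, J⟩
    by_cases hc : I.card = J.card
    · let e : I ≃ J := Finset.equivOfCardEq hc
      refine ⟨fun i j => ∃ hi : i ∈ I, (e ⟨i, hi⟩ : Fin n) = j, fun _ => ⟨fun i => ?_, fun j => ?_⟩⟩
      · by_cases hi : i ∈ I
        · simp [hi]
        · simp [hi]
      · have h1 : ∀ i, (∃ hi : i ∈ I, (e ⟨i, hi⟩ : Fin n) = j) ↔
            ∃ hj : j ∈ J, ((e.symm ⟨j, hj⟩ : I) : Fin m) = i := by
          intro i
          constructor
          · rintro ⟨hi, rfl⟩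
            exact ⟨(e ⟨i, hi⟩).2, by simp⟩
          · rintro ⟨hj, rfl⟩
            exact ⟨(e.symm ⟨j, hj⟩).2, by simp⟩
        by_cases hj : j ∈ J
        · simp [h1, hj]
        · simp [h1, hj]
    · exact ⟨fun _ _ => False, fun hc' => absurd hc' hc⟩
  choose M hM using hM
  let I : X → Finset (Fin m) := fun x => Finset.univ.filter fun i => x ∈ A i
  let J : X → Finset (Fin n) := fun x => Finset.univ.filter fun j => x ∈ B j
  have hI : IsLocallyConstant I := by
    have h1 : IsLocallyConstant fun x => fun i => (x ∈ A i : Prop) := by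
      rw [IsLocallyConstant.iff_eventually_eq]
      intro x
      have h2 : ∀ i, ∀ᶠ y in nhds x, (y ∈ A i) = (x ∈ A i) := by
        intro i
        by_cases hx : x ∈ A i
        · filter_upwards [(hA i).isOpen.mem_nhds hx] with y hy
          simp [hx, hy]
        · filter_upwards [(hA i).isClosed.isOpen_compl.mem_nhds hx] with y hy
          simpa [hx] using hy
      filter_upwards [Filter.eventually_all.2 h2] with y hy
      exact funext hy
    exact h1.comp fun P => Finset.univ.filter fun i => P i
  have hJ : IsLocallyConstant J := by
    have h1 : IsLocallyConstant fun x => fun j => (x ∈ B j : Prop) := by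
      rw [IsLocallyConstant.iff_eventually_eq]
      intro x
      have h2 : ∀ i, ∀ᶠ y in nhds x, (y ∈ B i) = (x ∈ B i) := by
        intro i
        by_cases hx : x ∈ B i
        · filter_upwards [(hB i).isOpen.mem_nhds hx] with y hy
          simp [hx, hy]
        · filter_upwards [(hB i).isClosed.isOpen_compl.mem_nhds hx] with y hy
          simpa [hx] using hy
      filter_upwards [Filter.eventually_all.2 h2] with y hy
      exact funext hy
    exact h1.comp fun P => Finset.univ.filter fun i => P i
  have hcard : ∀ x, (I x).card = (J x).card := by
    intro x
    have h1 := h x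
    simp only [indicator_apply, Finset.sum_boole] at h1
    exact_mod_cast h1
  refine ⟨fun i j => {x | M (I x, J x) i j}, fun i j => ?_, fun i x => ?_, fun j x => ?_⟩
  · exact ⟨⟨(hI.prodMk hJ) {p | M p i j}ᶜ⟩, (hI.prodMk hJ) {p | M p i j}⟩
  · have := (hM (I x, J x) (hcard x)).1 i
    simpa [I, indicator_apply] using this
  · have := (hM (I x, J x) (hcard x)).2 j
    simpa [J, indicator_apply] using this

lemma subset_of_indicator_sum {X ι : Type*} [Fintype ι] {A : Set X} {Z : ι → Set X}
    (h : ∀ x, A.indicator (fun _ => (1 : ℤ)) x = ∑ j, (Z j).indicator (fun _ => (1 : ℤ)) x)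
    (j : ι) : Z j ⊆ A := by
  intro x hx
  by_contra hA
  have h1 := h x
  rw [indicator_of_notMem hA] at h1
  have h2 := (Finset.sum_eq_zero_iff_of_nonneg fun k _ =>
    indicator_nonneg (fun _ _ => zero_le_one) x).1 h1.symm j (Finset.mem_univ j)
  rw [indicator_of_mem hx] at h2
  exact one_ne_zero h2

lemma typeRel_trans [T2Space G] [IsTopologicalGroupoid G] [IsEtale G] {f g h : PosCone G}
    (hfg : TypeRel G f g) (hgh : TypeRel G g h) : TypeRel G f h := by
  obtain ⟨m, E, hE, hf, hg⟩ := hfg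
  obtain ⟨n, F, hF, hg', hh⟩ := hgh
  let r' : G → UnitSpace G := fun a => ⟨r a, r_mem a⟩
  let s' : G → UnitSpace G := fun a => ⟨s a, s_mem a⟩
  have hr' : Continuous r' := continuous_r.subtype_mk _
  have hs' : Continuous s' := continuous_s.subtype_mk _
  obtain ⟨Z, hZ, hZA, hZB⟩ := exists_refinement
    (fun i => (Subtype.val ⁻¹' (r '' E i) : Set (UnitSpace G)))
    (fun j => (Subtype.val ⁻¹' (s '' F j) : Set (UnitSpace G)))
    (fun i => ⟨((hE i).isCompact.image continuous_r).isClosed.preimage continuous_subtype_val,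
      (hE i).isOpen_r.preimage continuous_subtype_val⟩)
    (fun j => ⟨((hF j).isCompact.image continuous_s).isClosed.preimage continuous_subtype_val,
      (hF j).isOpen_s.preimage continuous_subtype_val⟩)
    (fun x => (hg x).symm.trans (hg' x))
  have hE' : ∀ i j, IsCompactOpenBisection (E i ∩ r' ⁻¹' Z i j) := fun i j =>
    isCompactOpenBisection_of_injOn ((hE i).isCompact.inter_right ((hZ i j).isClosed.preimage hr'))
      ((hE i).isOpen.inter ((hZ i j).isOpen.preimage hr'))
      ((hE i).injOn_r.mono inter_subset_left) ((hE i).injOn_s.mono inter_subset_left)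
  have hF' : ∀ i j, IsCompactOpenBisection (F j ∩ s' ⁻¹' Z i j) := fun i j =>
    isCompactOpenBisection_of_injOn ((hF j).isCompact.inter_right ((hZ i j).isClosed.preimage hs'))
      ((hF j).isOpen.inter ((hZ i j).isOpen.preimage hs'))
      ((hF j).injOn_r.mono inter_subset_left) ((hF j).injOn_s.mono inter_subset_left)
  have hZE : ∀ i j, ∀ z ∈ Z i j, ∃ a ∈ E i, r' a = z := by
    intro i j z hz
    obtain ⟨a, ha, haz⟩ := subset_of_indicator_sum (hZA i) j hz
    exact ⟨a, ha, Subtype.ext haz⟩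
  have hZF : ∀ i j, ∀ z ∈ Z i j, ∃ b ∈ F j, s' b = z := by
    intro i j z hz
    obtain ⟨b, hb, hbz⟩ := subset_of_indicator_sum (hZB j) i hz
    exact ⟨b, hb, Subtype.ext hbz⟩
  have key_s : ∀ i j (x : G), x ∈ s '' setMul (F j ∩ s' ⁻¹' Z i j) (E i ∩ r' ⁻¹' Z i j) ↔
      ∃ a ∈ E i, s a = x ∧ r' a ∈ Z i j := by
    intro i j x
    constructor
    · rintro ⟨_, ⟨b, hb, a, ha, hba, rfl⟩, rfl⟩
      exact ⟨a, ha.1, (s_mul b a hba).symm, ha.2⟩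
    · rintro ⟨a, ha, rfl, haz⟩
      obtain ⟨b, hb, hbz⟩ := hZF i j _ haz
      exact ⟨mul b a (congrArg Subtype.val hbz),
        ⟨b, ⟨hb, by rw [mem_preimage, hbz]; exact haz⟩, a, ⟨ha, haz⟩, _, rfl⟩, s_mul _ _ _⟩
  have key_r : ∀ i j (x : G), x ∈ r '' setMul (F j ∩ s' ⁻¹' Z i j) (E i ∩ r' ⁻¹' Z i j) ↔
      ∃ b ∈ F j, r b = x ∧ s' b ∈ Z i j := by
    intro i j x
    constructor
    · rintro ⟨_, ⟨b, hb, a, ha, hba, rfl⟩, rfl⟩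
      exact ⟨b, hb.1, (r_mul b a hba).symm, hb.2⟩
    · rintro ⟨b, hb, rfl, hbz⟩
      obtain ⟨a, ha, haz⟩ := hZE i j _ hbz
      exact ⟨mul b a (congrArg Subtype.val haz).symm,
        ⟨b, ⟨hb, hbz⟩, a, ⟨ha, by rw [mem_preimage, haz]; exact hbz⟩, _, rfl⟩, r_mul _ _ _⟩
  refine typeRel_of_fintype (ι := Fin m × Fin n)
    (fun p => setMul (F p.2 ∩ s' ⁻¹' Z p.1 p.2) (E p.1 ∩ r' ⁻¹' Z p.1 p.2))
    (fun p => isCompactOpenBisection_mul (hF' p.1 p.2) (hE' p.1 p.2)) (fun x => ?_) (fun x => ?_)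
  · rw [hf x, Fintype.sum_prod_type]
    refine Finset.sum_congr rfl fun i _ => ?_
    by_cases hx : (x : G) ∈ s '' E i
    · obtain ⟨a, ha, hax⟩ := hx
      have h1 := hZA i (r' a)
      rw [indicator_of_mem (show r' a ∈ Subtype.val ⁻¹' (r '' E i) from ⟨a, ha, rfl⟩)] at h1
      rw [indicator_of_mem (show (x : G) ∈ s '' E i from ⟨a, ha, hax⟩)]
      refine h1.trans (Finset.sum_congr rfl fun j _ => ?_)
      have h2 : (x : G) ∈ s '' setMul (F j ∩ s' ⁻¹' Z i j) (E i ∩ r' ⁻¹' Z i j) ↔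
          r' a ∈ Z i j := by
        rw [key_s]
        constructor
        · rintro ⟨a', ha', hax', hz⟩
          rwa [← (hE i).injOn_s ha' ha (hax'.trans hax.symm)]
        · intro hz
          exact ⟨a, ha, hax, hz⟩
      by_cases hz : r' a ∈ Z i j
      · rw [indicator_of_mem hz, indicator_of_mem (h2.2 hz)]
      · rw [indicator_of_notMem hz, indicator_of_notMem (mt h2.1 hz)]
    · rw [indicator_of_notMem hx]
      refine (Finset.sum_eq_zero fun j _ => indicator_of_notMem ?_ _).symm
      rw [key_s]
      rintro ⟨a, ha, hax, -⟩
      exact hx ⟨a, ha, hax⟩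
  · rw [hh x, Fintype.sum_prod_type, Finset.sum_comm]
    refine Finset.sum_congr rfl fun j _ => ?_
    by_cases hx : (x : G) ∈ r '' F j
    · obtain ⟨b, hb, hbx⟩ := hx
      have h1 := hZB j (s' b)
      rw [indicator_of_mem (show s' b ∈ Subtype.val ⁻¹' (s '' F j) from ⟨b, hb, rfl⟩)] at h1
      rw [indicator_of_mem (show (x : G) ∈ r '' F j from ⟨b, hb, hbx⟩)]
      refine h1.trans (Finset.sum_congr rfl fun i _ => ?_)
      have h2 : (x : G) ∈ r '' setMul (F j ∩ s' ⁻¹' Z i j) (E i ∩ r' ⁻¹' Z i j) ↔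
          s' b ∈ Z i j := by
        rw [key_r]
        constructor
        · rintro ⟨b', hb', hbx', hz⟩
          rwa [← (hF j).injOn_r hb' hb (hbx'.trans hbx.symm)]
        · intro hz
          exact ⟨b, hb, hbx, hz⟩
      by_cases hz : s' b ∈ Z i j
      · rw [indicator_of_mem hz, indicator_of_mem (h2.2 hz)]
      · rw [indicator_of_notMem hz, indicator_of_notMem (mt h2.1 hz)]
    · rw [indicator_of_notMem hx]
      refine (Finset.sum_eq_zero fun i _ => indicator_of_notMem ?_ _).symm
      rw [key_r]
      rintro ⟨b, hb, hbx, -⟩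
      exact hx ⟨b, hb, hbx⟩

end Congruence

/-! ### The type semigroup -/

section TypeSemigroup

variable (G : Type u) [ArrowGroupoid G] [TopologicalSpace G] [T2Space G]
  [IsTopologicalGroupoid G] [IsEtale G]

/-- The relation `∼` as an additive congruence on `C_c(G⁽⁰⁾, ℤ)⁺`. -/
def typeCon : AddCon (PosCone G) where
  r := TypeRel G
  iseqv := ⟨typeRel_refl, typeRel_symm, typeRel_trans⟩
  add' := typeRel_add

/-- The type semigroup `S(G) = C_c(G⁽⁰⁾, ℤ)⁺ / ∼`, an abelian monoid under
`[f] + [g] = [f + g]`. -/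
abbrev TypeSemigroup : Type u := (typeCon G).Quotient

end TypeSemigroup

/-! ### Equivalence of groupoids -/

section Equivalence

variable (G : Type u) [ArrowGroupoid G] [TopologicalSpace G]
  (H : Type v) [ArrowGroupoid H] [TopologicalSpace H]
  (Z : Type w) [TopologicalSpace Z]

/-- A (continuous) left `G`-space: a continuous open moment map `ρ : Z → G⁽⁰⁾` and a continuous
action `g · z`, defined when `s(g) = ρ(z)`. -/
structure LeftSpace where
  /-- the moment map -/
  ρ : Z → UnitSpace G
  continuous_ρ : Continuous ρ
  isOpenMap_ρ : IsOpenMap ρ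
  /-- the action -/
  act : (g : G) → (z : Z) → s g = (ρ z : G) → Z
  ρ_act : ∀ g z h, (ρ (act g z h) : G) = r g
  unit_act : ∀ z, act (ρ z) z (s_unit _ (ρ z).2) = z
  mul_act : ∀ (g g' : G) (z : Z) (h : s g = r g') (k : s g' = (ρ z : G)),
    act (mul g g' h) z ((s_mul g g' h).trans k) = act g (act g' z k) (h.trans (ρ_act g' z k).symm)
  continuous_act : Continuous fun p : {p : G × Z // s p.1 = (ρ p.2 : G)} => act p.1.1 p.1.2 p.2

/-- A (continuous) right `H`-space: a continuous open moment map `σ : Z → H⁽⁰⁾` and a continuous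
action `z · h`, defined when `σ(z) = r(h)`. -/
structure RightSpace where
  /-- the moment map -/
  σ : Z → UnitSpace H
  continuous_σ : Continuous σ
  isOpenMap_σ : IsOpenMap σ
  /-- the action -/
  act : (z : Z) → (h : H) → (σ z : H) = r h → Z
  σ_act : ∀ z h k, (σ (act z h k) : H) = s h
  act_unit : ∀ z, act z (σ z) (r_unit _ (σ z).2).symm = z
  act_mul : ∀ (z : Z) (h h' : H) (k : (σ z : H) = r h) (l : s h = r h'),
    act z (mul h h' l) (k.trans (r_mul h h' l).symm) = act (act z h k) h' ((σ_act z h k).trans l)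
  continuous_act : Continuous fun p : {p : Z × H // (σ p.1 : H) = r p.2} => act p.1.1 p.1.2 p.2

variable {G H Z}

/-- The action is free: `g · z = z` only if `g` is a unit. -/
def LeftSpace.IsFree (L : LeftSpace G Z) : Prop :=
  ∀ g z h, L.act g z h = z → g ∈ (units : Set G)

/-- The action is proper: `(g, z) ↦ (g · z, z)` is a proper map into `Z × Z`. -/
def LeftSpace.IsProper (L : LeftSpace G Z) : Prop :=
  IsProperMap fun p : {p : G × Z // s p.1 = (L.ρ p.2 : G)} => (L.act p.1.1 p.1.2 p.2, p.1.2)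

/-- The action is free: `z · h = z` only if `h` is a unit. -/
def RightSpace.IsFree (R : RightSpace H Z) : Prop :=
  ∀ z h k, R.act z h k = z → h ∈ (units : Set H)

/-- The action is proper: `(z, h) ↦ (z · h, z)` is a proper map into `Z × Z`. -/
def RightSpace.IsProper (R : RightSpace H Z) : Prop :=
  IsProperMap fun p : {p : Z × H // (R.σ p.1 : H) = r p.2} => (R.act p.1.1 p.1.2 p.2, p.1.1)

variable (G H Z)

/-- A `(G, H)`-equivalence: a free and proper left `G`-space and free and proper right `H`-space
such that the actions commute, `ρ` induces a bijection `Z / H → G⁽⁰⁾` and `σ` induces a bijection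
`G \ Z → H⁽⁰⁾`. -/
structure GroupoidEquivalence where
  /-- the left `G`-space structure -/
  left : LeftSpace G Z
  /-- the right `H`-space structure -/
  right : RightSpace H Z
  left_free : left.IsFree
  left_proper : left.IsProper
  right_free : right.IsFree
  right_proper : right.IsProper
  /-- `ρ` is invariant under the action of `H` -/
  ρ_right : ∀ z h k, left.ρ (right.act z h k) = left.ρ z
  /-- `σ` is invariant under the action of `G` -/
  σ_left : ∀ g z k, right.σ (left.act g z k) = right.σ z
  /-- the actions commute: `(g · z) · h = g · (z · h)` -/
  act_comm : ∀ (g : G) (z : Z) (h : H) (k : s g = (left.ρ z : G)) (l : (right.σ z : H) = r h),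
    right.act (left.act g z k) h ((congrArg Subtype.val (σ_left g z k)).trans l) =
      left.act g (right.act z h l) (k.trans (congrArg Subtype.val (ρ_right z h l)).symm)
  ρ_surjective : Function.Surjective left.ρ
  /-- the fibres of `ρ` are `H`-orbits -/
  ρ_fibre : ∀ z z', left.ρ z = left.ρ z' → ∃ h k, right.act z h k = z'
  σ_surjective : Function.Surjective right.σ
  /-- the fibres of `σ` are `G`-orbits -/
  σ_fibre : ∀ z z', right.σ z = right.σ z' → ∃ g k, left.act g z k = z'

end Equivalence

/-- `G` and `H` are groupoid equivalent: there is a locally compact Hausdorff space which is a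
`(G, H)`-equivalence. -/
def AreEquivalent (G : Type u) [ArrowGroupoid G] [TopologicalSpace G]
    (H : Type v) [ArrowGroupoid H] [TopologicalSpace H] : Prop :=
  ∃ (Z : Type w) (_ : TopologicalSpace Z),
    LocallyCompactSpace Z ∧ T2Space Z ∧ Nonempty (GroupoidEquivalence G H Z)

end AmpleGpd

namespace AmpleGpd

open ArrowGroupoid Topology

/-! ### Relations defined by spans of local homeomorphisms -/

section Span

variable {A B C X Y W : Type*} [TopologicalSpace A] [TopologicalSpace B] [TopologicalSpace C]

/-! The relation defining `S(G)` is the relation `SpanRel` of the span of units `G⁽⁰⁾ ← G → G⁽⁰⁾`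
with legs `s` and `r`. An equivalence space `Z` gives a span `G⁽⁰⁾ ← Z → H⁽⁰⁾` with legs `ρ` and
`σ`, and its relation is used as a correspondence between positive functions on the two unit spaces.
This correspondence induces the isomorphism.

Everything rests on one composition principle, `SpanRel.comp`: when two spans meet in a middle
space, a continuous map from their fibre product to a third span, compatible with the outer legs,
composes the relations. Four such maps occur. The actions of `G` and `H` on `Z` show that the
correspondence absorbs equivalences on either side. The transporters, sending two points of a common
`ρ`-fibre to the element of `H` joining them, and dually for `σ` and `G`, show that two functions
with a common partner are equivalent.

The transporters are well defined by freeness and continuous by properness. They also make the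
moment maps locally injective: on the diagonal they take unit values, units form an open set because
the groupoid is étale, and a unit transporter means that the two points coincide. Since `ρ` and `σ`
are also continuous and open, they are local homeomorphisms. As the unit spaces have bases of
compact open sets, `Z` is then covered by bisections, every positive function breaks into finitely
many bisection images, and it has a partner on the other side. -/

/-- A compact open subset of `A` on which both legs of the span `X ← A → Y` are injective. -/
structure IsSpanBisection (p : A → X) (q : A → Y) (E : Set A) : Prop where
  isCompact : IsCompact E
  isOpen : IsOpen E
  injOn_left : InjOn p E
  injOn_right : InjOn q E

/-- `f` and `g` are related by the span `X ← A → Y` if there are finitely many bisections `Eᵢ` with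
`f = ∑ 1_{p(Eᵢ)}` and `g = ∑ 1_{q(Eᵢ)}`. -/
def SpanRel (p : A → X) (q : A → Y) (f : X → ℤ) (g : Y → ℤ) : Prop :=
  ∃ (n : ℕ) (E : Fin n → Set A), (∀ i, IsSpanBisection p q (E i)) ∧
    (∀ x, f x = ∑ i, (p '' E i).indicator (fun _ => (1 : ℤ)) x) ∧
    (∀ y, g y = ∑ i, (q '' E i).indicator (fun _ => (1 : ℤ)) y)

/-- A map is locally injective if every point has a neighbourhood on which it is injective. -/
def LocInjective (p : A → X) : Prop := ∀ a, ∃ U ∈ 𝓝 a, InjOn p U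

lemma IsSpanBisection.inter {p : A → X} {q : A → Y} {E T : Set A} (hE : IsSpanBisection p q E)
    (hT : IsClopen T) : IsSpanBisection p q (E ∩ T) where
  isCompact := hE.isCompact.inter_right hT.isClosed
  isOpen := hE.isOpen.inter hT.isOpen
  injOn_left := hE.injOn_left.mono inter_subset_left
  injOn_right := hE.injOn_right.mono inter_subset_left

lemma IsSpanBisection.swap {p : A → X} {q : A → Y} {E : Set A} (hE : IsSpanBisection p q E) :
    IsSpanBisection q p E :=
  ⟨hE.isCompact, hE.isOpen, hE.injOn_right, hE.injOn_left⟩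

lemma SpanRel.swap {p : A → X} {q : A → Y} {f : X → ℤ} {g : Y → ℤ} (h : SpanRel p q f g) :
    SpanRel q p g f := by
  obtain ⟨n, E, hE, hf, hg⟩ := h
  exact ⟨n, E, fun i => (hE i).swap, hg, hf⟩

lemma SpanRel.of_fintype {ι : Type*} [Fintype ι] {p : A → X} {q : A → Y} {f : X → ℤ} {g : Y → ℤ}
    (E : ι → Set A) (hE : ∀ i, IsSpanBisection p q (E i))
    (hf : ∀ x, f x = ∑ i, (p '' E i).indicator (fun _ => (1 : ℤ)) x)
    (hg : ∀ y, g y = ∑ i, (q '' E i).indicator (fun _ => (1 : ℤ)) y) : SpanRel p q f g := by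
  let e := (Fintype.equivFin ι).symm
  refine ⟨Fintype.card ι, E ∘ e, fun i => hE _, fun x => ?_, fun y => ?_⟩
  · rw [hf x]
    exact (e.sum_comp fun i => (p '' E i).indicator (fun _ => (1 : ℤ)) x).symm
  · rw [hg y]
    exact (e.sum_comp fun i => (q '' E i).indicator (fun _ => (1 : ℤ)) y).symm

lemma SpanRel.add {p : A → X} {q : A → Y} {f f' : X → ℤ} {g g' : Y → ℤ}
    (h : SpanRel p q f g) (h' : SpanRel p q f' g') : SpanRel p q (f + f') (g + g') := by
  obtain ⟨m, E, hE, hf, hg⟩ := h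
  obtain ⟨n, F, hF, hf', hg'⟩ := h'
  refine .of_fintype (ι := Fin m ⊕ Fin n) (Sum.elim E F) ?_ ?_ ?_
  · rintro (i | i)
    exacts [hE i, hF i]
  · intro x
    rw [Fintype.sum_sum_type]
    exact congrArg₂ (· + ·) (hf x) (hf' x)
  · intro x
    rw [Fintype.sum_sum_type]
    exact congrArg₂ (· + ·) (hg x) (hg' x)

/-- A partition of `q(E)` induces a partition of `p(E)`. -/
lemma IsSpanBisection.indicator_image {p : A → X} {q : A → Y} {E : Set A}
    (hE : IsSpanBisection p q E) {ι : Type*} [Fintype ι] {T : ι → Set Y}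
    (hT : ∀ y, (q '' E).indicator (fun _ => (1 : ℤ)) y
      = ∑ j, (T j).indicator (fun _ => (1 : ℤ)) y) (x : X) :
    (p '' E).indicator (fun _ => (1 : ℤ)) x
      = ∑ j, (p '' (E ∩ q ⁻¹' T j)).indicator (fun _ => (1 : ℤ)) x := by
  by_cases hx : x ∈ p '' E
  · obtain ⟨a, ha, rfl⟩ := hx
    have h1 := hT (q a)
    rw [indicator_of_mem (mem_image_of_mem q ha)] at h1
    rw [indicator_of_mem (mem_image_of_mem p ha)]
    refine h1.trans (Finset.sum_congr rfl fun j _ => ?_)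
    have h2 : p a ∈ p '' (E ∩ q ⁻¹' T j) ↔ q a ∈ T j := by
      constructor
      · rintro ⟨a', ⟨ha', hz⟩, hh⟩
        rwa [← hE.injOn_left ha' ha hh]
      · exact fun hz => ⟨a, ⟨ha, hz⟩, rfl⟩
    by_cases hz : q a ∈ T j
    · rw [indicator_of_mem hz, indicator_of_mem (h2.2 hz)]
    · rw [indicator_of_notMem hz, indicator_of_notMem (mt h2.1 hz)]
  · rw [indicator_of_notMem hx]
    refine (Finset.sum_eq_zero fun j _ => indicator_of_notMem ?_ _).symm
    exact fun h => hx (image_mono inter_subset_left h)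

/-! ### Covering spans and compact open sets by bisections. -/

variable [TopologicalSpace X]

/-- If compact open sets form a neighbourhood basis in `X`, bisections cover a span whose legs are
locally injective. -/
lemma exists_isSpanBisection {p : A → X} {q : A → Y} (hp : Continuous p) (hpo : IsOpenMap p)
    (hpi : LocInjective p) (hqi : LocInjective q)
    (hX : ∀ x : X, ∀ U ∈ 𝓝 x, ∃ V ⊆ U, x ∈ V ∧ IsCompact V ∧ IsOpen V) (a : A) :
    ∃ E, a ∈ E ∧ IsSpanBisection p q E := by
  obtain ⟨U₁, hU₁, hi₁⟩ := hpi a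
  obtain ⟨U₂, hU₂, hi₂⟩ := hqi a
  obtain ⟨U, hUs, hU, haU⟩ := mem_nhds_iff.1 (Filter.inter_mem hU₁ hU₂)
  have hpU : InjOn p U := hi₁.mono fun x hx => (hUs hx).1
  have hqU : InjOn q U := hi₂.mono fun x hx => (hUs hx).2
  obtain ⟨V, hVs, haV, hVc, hVo⟩ := hX (p a) _ ((hpo U hU).mem_nhds ⟨a, haU, rfl⟩)
  refine ⟨U ∩ p ⁻¹' V, ⟨haU, haV⟩, ?_, hU.inter (hVo.preimage hp), hpU.mono inter_subset_left,
    hqU.mono inter_subset_left⟩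
  -- Compactness of `U ∩ p ⁻¹' V` comes from that of `V`: on `U` the map `p` is a homeomorphism onto
  -- an open set containing `V`, so the set is a homeomorphic copy of `V`.
  have he : IsOpenEmbedding (U.domRestrict p) := .of_continuous_injective_isOpenMap
    (hp.comp continuous_subtype_val) (injOn_iff_injective.1 hpU)
    (hpo.comp hU.isOpenMap_subtype_val)
  have h1 : U.domRestrict p '' {u | p u ∈ V} = V := by
    ext x
    constructor
    · rintro ⟨u, hu, rfl⟩
      exact hu
    · intro hx
      obtain ⟨u, hu, rfl⟩ := hVs hx
      exact ⟨⟨u, hu⟩, hx, rfl⟩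
  have h2 : IsCompact {u : U | p u ∈ V} := by
    rw [he.isInducing.isCompact_iff, h1]
    exact hVc
  convert h2.image continuous_subtype_val using 1
  ext x
  constructor
  · rintro ⟨hx, hxV⟩
    exact ⟨⟨x, hx⟩, hxV, rfl⟩
  · rintro ⟨u, hu, rfl⟩
    exact ⟨u.2, hu⟩

/-- A compact open set is a disjoint union of images of bisections. -/
lemma exists_indicator_eq_sum [T2Space X] {p : A → X} {q : A → Y} (hp : Continuous p)
    (hpo : IsOpenMap p) (hps : Function.Surjective p)
    (hE : ∀ a, ∃ E, a ∈ E ∧ IsSpanBisection p q E) {S : Set X} (hSc : IsCompact S)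
    (hSo : IsOpen S) :
    ∃ (n : ℕ) (E : Fin n → Set A), (∀ i, IsSpanBisection p q (E i)) ∧
      ∀ x, S.indicator (fun _ => (1 : ℤ)) x
        = ∑ i, (p '' E i).indicator (fun _ => (1 : ℤ)) x := by
  classical
  choose N hN hNb using hE
  -- Induction on a finite cover, generalised over `S`. Removing `p '' N a` leaves a set that is
  -- still compact open, because that image is open and, being compact in a Hausdorff space, closed.
  -- The removed part is the image of the bisection `N a ∩ p ⁻¹' S`. Hence the sum has no overlaps.
  have key : ∀ (t : Finset A) (S : Set X), IsCompact S → IsOpen S → S ⊆ ⋃ a ∈ t, p '' N a →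
      ∃ (n : ℕ) (E : Fin n → Set A), (∀ i, IsSpanBisection p q (E i)) ∧
        ∀ x, S.indicator (fun _ => (1 : ℤ)) x
          = ∑ i, (p '' E i).indicator (fun _ => (1 : ℤ)) x := by
    intro t
    induction t using Finset.induction_on with
    | empty =>
      intro S _ _ hS
      have : S = ∅ := by simpa using hS
      exact ⟨0, fun _ => ∅, fun i => i.elim0, fun x => by simp [this]⟩
    | insert a t _ ih =>
      intro S hSc hSo hS
      have hNo : IsOpen (p '' N a) := hpo _ (hNb a).isOpen
      have hNc : IsClosed (p '' N a) := ((hNb a).isCompact.image hp).isClosed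
      obtain ⟨n, E, hE, hsum⟩ := ih (S \ p '' N a) (hSc.diff hNo) (hSo.sdiff hNc) (by
        rintro x ⟨hx, hxa⟩
        have := hS hx
        rw [Finset.set_biUnion_insert] at this
        exact this.resolve_left hxa)
      refine ⟨n + 1, Fin.cons (N a ∩ p ⁻¹' S) E, ?_, fun x => ?_⟩
      · intro i
        refine Fin.cases ?_ (fun i => ?_) i
        · exact (hNb a).inter ⟨hSc.isClosed.preimage hp, hSo.preimage hp⟩
        · exact hE i
      · rw [Fin.sum_univ_succ]
        simp only [Fin.cons_zero, Fin.cons_succ]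
        rw [← hsum x, image_inter_preimage]
        by_cases h1 : x ∈ S <;> by_cases h2 : x ∈ p '' N a <;> simp only [indicator_apply,
          mem_inter_iff, mem_sdiff, h1, h2] <;> simp
  obtain ⟨t, ht⟩ := hSc.elim_finite_subcover (fun a => p '' N a)
    (fun a => hpo _ (hNb a).isOpen) (fun x _ => by
      obtain ⟨a, rfl⟩ := hps x
      exact mem_iUnion.2 ⟨a, a, hN a, rfl⟩)
  exact key t S hSc hSo ht

/-! ### Fibre products of bisections and composition of spans. -/

variable [TopologicalSpace Y]

/-- The image under `m` of the pairs in `E × F` that lie over the same point. -/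
def fibreProd {q : A → Y} {p : B → Y} (m : {x : A × B // q x.1 = p x.2} → C) (E : Set A)
    (F : Set B) : Set C := m '' (Subtype.val ⁻¹' E ×ˢ F)

/-- Compactness holds because the fibre product is closed in `A × B` when `Y` is Hausdorff.
Injectivity of an outer leg passes from one factor to the other through the common point of `Y`.
Openness needs no openness of `m`: local injectivity of `pC` replaces it. -/
lemma isSpanBisection_fibreProd [T2Space Y] {pA : A → X} {qA : A → Y} {pB : B → Y} {qB : B → W}
    {pC : C → X} {qC : C → W} (m : {x : A × B // qA x.1 = pB x.2} → C) (hm : Continuous m)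
    (hmp : ∀ x, pC (m x) = pA x.1.1) (hmq : ∀ x, qC (m x) = qB x.1.2)
    (hpA : IsOpenMap pA) (hqA : Continuous qA) (hpB : Continuous pB) (hpBo : IsOpenMap pB)
    (hpC : Continuous pC) (hpCi : LocInjective pC) {E : Set A} {F : Set B}
    (hE : IsSpanBisection pA qA E) (hF : IsSpanBisection pB qB F) :
    IsSpanBisection pC qC (fibreProd m E F) where
  isCompact := by
    have hcl : IsClosed {x : A × B | qA x.1 = pB x.2} :=
      isClosed_eq (hqA.comp continuous_fst) (hpB.comp continuous_snd)
    exact (hcl.isClosedEmbedding_subtypeVal.isCompact_preimage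
      (hE.isCompact.prod hF.isCompact)).image hm
  isOpen := by
    rw [isOpen_iff_mem_nhds]
    rintro _ ⟨⟨⟨a, b⟩, hab⟩, ⟨ha, hb⟩, rfl⟩
    obtain ⟨N, hN, hNi⟩ := hpCi (m ⟨(a, b), hab⟩)
    have h1 : m ⁻¹' N ∩ Subtype.val ⁻¹' E ×ˢ F ∈ 𝓝 (⟨(a, b), hab⟩ :
        {x : A × B // qA x.1 = pB x.2}) :=
      Filter.inter_mem (hm.continuousAt hN)
        (continuous_subtype_val.continuousAt
          ((hE.isOpen.prod hF.isOpen).mem_nhds (show (a, b) ∈ E ×ˢ F from ⟨ha, hb⟩)))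
    obtain ⟨O, hO, hOs⟩ := mem_nhds_subtype _ _ _ |>.1 h1
    obtain ⟨U, V, hU, haU, hV, hbV, hUV⟩ := mem_nhds_prod_iff'.1 hO
    have hD : IsOpen (pA '' (U ∩ qA ⁻¹' (pB '' V))) :=
      hpA _ (hU.inter ((hpBo _ hV).preimage hqA))
    have hmem : pC (m ⟨(a, b), hab⟩) ∈ pA '' (U ∩ qA ⁻¹' (pB '' V)) :=
      ⟨a, ⟨haU, b, hbV, hab.symm⟩, (hmp ⟨(a, b), hab⟩).symm⟩
    -- A point `c` near `m (a, b)` has its `pC`-value in the open set of values `pA a'` with `(a',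
    -- b')` a pair close to `(a, b)`. Then `m (a', b')` and `c` lie in `N` with the same `pC`-value,
    -- so they are equal.
    filter_upwards [hN, hpC.continuousAt (hD.mem_nhds hmem)] with c hcN hcD
    obtain ⟨a', ⟨haU', b', hbV', hab'⟩, hac⟩ := hcD
    have h2 := hOs (show (⟨(a', b'), hab'.symm⟩ : {x : A × B // qA x.1 = pB x.2}) ∈
      Subtype.val ⁻¹' O from hUV ⟨haU', hbV'⟩)
    refine ⟨_, h2.2, hNi h2.1 hcN ?_⟩
    rw [hmp]
    exact hac
  injOn_left := by
    rintro _ ⟨⟨⟨a, b⟩, hab⟩, ⟨ha, hb⟩, rfl⟩ _ ⟨⟨⟨a', b'⟩, hab'⟩, ⟨ha', hb'⟩, rfl⟩ h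
    rw [hmp, hmp] at h
    obtain rfl := hE.injOn_left ha ha' h
    obtain rfl := hF.injOn_left hb hb' (hab.symm.trans hab')
    rfl
  injOn_right := by
    rintro _ ⟨⟨⟨a, b⟩, hab⟩, ⟨ha, hb⟩, rfl⟩ _ ⟨⟨⟨a', b'⟩, hab'⟩, ⟨ha', hb'⟩, rfl⟩ h
    rw [hmq, hmq] at h
    obtain rfl := hF.injOn_right hb hb' h
    obtain rfl := hE.injOn_right ha ha' (hab.trans hab'.symm)
    rfl

/-- Composition of the relations defined by two spans, along a continuous map from the fibre
product to a third span. -/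
lemma SpanRel.comp [T2Space Y] {pA : A → X} {qA : A → Y} {pB : B → Y} {qB : B → W}
    {pC : C → X} {qC : C → W} (m : {x : A × B // qA x.1 = pB x.2} → C) (hm : Continuous m)
    (hmp : ∀ x, pC (m x) = pA x.1.1) (hmq : ∀ x, qC (m x) = qB x.1.2)
    (hpA : IsOpenMap pA) (hqA : Continuous qA) (hqAo : IsOpenMap qA) (hpB : Continuous pB)
    (hpBo : IsOpenMap pB) (hpC : Continuous pC) (hpCi : LocInjective pC)
    {f : X → ℤ} {g : Y → ℤ} {h : W → ℤ} (hfg : SpanRel pA qA f g) (hgh : SpanRel pB qB g h) :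
    SpanRel pC qC f h := by
  obtain ⟨k, E, hE, hf, hg⟩ := hfg
  obtain ⟨n, F, hF, hg', hh⟩ := hgh
  obtain ⟨T, hT, hTA, hTB⟩ := exists_refinement (fun i => qA '' E i) (fun j => pB '' F j)
    (fun i => ⟨((hE i).isCompact.image hqA).isClosed, hqAo _ (hE i).isOpen⟩)
    (fun j => ⟨((hF j).isCompact.image hpB).isClosed, hpBo _ (hF j).isOpen⟩)
    (fun y => (hg y).symm.trans (hg' y))
  -- Nothing is lost in passing to the fibre product: `T i j` lies in both `qA '' E i` and `pB '' F
  -- j`, so each point of one restricted bisection has a match in the other.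
  have hl : ∀ i j, pC '' fibreProd m (E i ∩ qA ⁻¹' T i j) (F j ∩ pB ⁻¹' T i j)
      = pA '' (E i ∩ qA ⁻¹' T i j) := by
    intro i j
    ext x
    constructor
    · rintro ⟨_, ⟨⟨⟨a, b⟩, hab⟩, ⟨ha, -⟩, rfl⟩, rfl⟩
      exact ⟨a, ha, (hmp ⟨(a, b), hab⟩).symm⟩
    · rintro ⟨a, ha, rfl⟩
      obtain ⟨b, hb, hbz⟩ := subset_of_indicator_sum (hTB j) i ha.2
      exact ⟨_, ⟨⟨(a, b), hbz.symm⟩, ⟨ha, hb, by rw [mem_preimage, hbz]; exact ha.2⟩, rfl⟩, hmp _⟩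
  have hr : ∀ i j, qC '' fibreProd m (E i ∩ qA ⁻¹' T i j) (F j ∩ pB ⁻¹' T i j)
      = qB '' (F j ∩ pB ⁻¹' T i j) := by
    intro i j
    ext x
    constructor
    · rintro ⟨_, ⟨⟨⟨a, b⟩, hab⟩, ⟨-, hb⟩, rfl⟩, rfl⟩
      exact ⟨b, hb, (hmq ⟨(a, b), hab⟩).symm⟩
    · rintro ⟨b, hb, rfl⟩
      obtain ⟨a, ha, haz⟩ := subset_of_indicator_sum (hTA i) j hb.2
      exact ⟨_, ⟨⟨(a, b), haz⟩, ⟨⟨ha, by rw [mem_preimage, haz]; exact hb.2⟩, hb⟩, rfl⟩, hmq _⟩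
  refine .of_fintype (ι := Fin k × Fin n)
    (fun x => fibreProd m (E x.1 ∩ qA ⁻¹' T x.1 x.2) (F x.2 ∩ pB ⁻¹' T x.1 x.2))
    (fun x => isSpanBisection_fibreProd m hm hmp hmq hpA hqA hpB hpBo hpC hpCi
      ((hE _).inter ((hT _ _).preimage hqA)) ((hF _).inter ((hT _ _).preimage hpB)))
    (fun x => ?_) (fun w => ?_)
  · rw [hf x, Fintype.sum_prod_type]
    simp only [hl]
    exact Finset.sum_congr rfl fun i _ => (hE i).indicator_image (hTA i) x
  · rw [hh w, Fintype.sum_prod_type, Finset.sum_comm]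
    simp only [hr]
    exact Finset.sum_congr rfl fun j _ => (hF j).swap.indicator_image (hTB j) w

end Span
/-! ### The type semigroup relation as the relation of a span -/

section Groupoid

variable {G : Type u} [ArrowGroupoid G]

/-- The range map with values in the unit space. -/
def rangeMap (a : G) : UnitSpace G := ⟨r a, r_mem a⟩

/-- The source map with values in the unit space. -/
def sourceMap (a : G) : UnitSpace G := ⟨s a, s_mem a⟩

lemma mul_mem_units {a b : G} (h : s a = r (inv b)) (hu : mul a (inv b) h ∈ (units : Set G)) :
    a = b := by
  have hab : s a = s b := h.trans (r_inv b)
  have h1 : mul a (inv b) h = r b := by rw [← s_unit _ hu, s_mul, s_inv]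
  exact (mul_inv_mul_cancel a b hab).symm.trans ((mul_congr _ _ h1 rfl).trans (r_mul_self b))

/-- Together with `mul_mem_units`, this turns freeness, which concerns stabilisers, into
cancellation for left and right actions. -/
lemma inv_mul_mem_units {a b : G} (h : s (inv b) = r a) (hu : mul (inv b) a h ∈ (units : Set G)) :
    a = b := by
  have hba : r b = r a := (s_inv b).symm.trans h
  have h1 : mul (inv b) a h = s a := by rw [← s_unit _ hu, s_mul]
  have h2 : s a = s b := by
    rw [← h1, ← r_unit _ hu, r_mul, r_inv]
  have h3 : mul b (mul (inv b) a h) ((r_inv b).symm.trans (r_mul _ _ _).symm) = a := by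
    rw [← mul_assoc b (inv b) a (r_inv b).symm h]
    exact (mul_congr _ (s_unit _ (r_mem a)) ((mul_inv b).trans hba) rfl).trans (r_mul_self a)
  rw [← h3]
  exact (mul_congr _ (r_unit _ (s_mem b)).symm rfl (h1.trans h2)).trans (mul_s_self b)

variable [TopologicalSpace G]

section Etale

variable [IsEtale G]

lemma continuous_rangeMap : Continuous (rangeMap : G → UnitSpace G) :=
  continuous_r.subtype_mk _

lemma continuous_sourceMap : Continuous (sourceMap : G → UnitSpace G) :=
  continuous_s.subtype_mk _

lemma isOpenMap_rangeMap : IsOpenMap (rangeMap : G → UnitSpace G) :=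
  (IsEtale.isLocalHomeomorph_r (G := G)).isOpenMap.subtype_mk _

lemma isOpenMap_sourceMap : IsOpenMap (sourceMap : G → UnitSpace G) :=
  (IsEtale.isLocalHomeomorph_s (G := G)).isOpenMap.subtype_mk _

lemma locInjective_rangeMap : LocInjective (rangeMap : G → UnitSpace G) := fun a => by
  obtain ⟨e, ha, he⟩ := IsEtale.isLocalHomeomorph_r (G := G) a
  refine ⟨e.source, e.open_source.mem_nhds ha, fun x hx y hy h => e.injOn hx hy ?_⟩
  rw [← he]
  exact congrArg Subtype.val h

lemma locInjective_sourceMap : LocInjective (sourceMap : G → UnitSpace G) := fun a => by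
  obtain ⟨e, ha, he⟩ := IsEtale.isLocalHomeomorph_s (G := G) a
  refine ⟨e.source, e.open_source.mem_nhds ha, fun x hx y hy h => e.injOn hx hy ?_⟩
  rw [← he]
  exact congrArg Subtype.val h

/-- In an étale groupoid, injectivity of `r` and `s` on a compact open set already makes it a
bisection, so the two notions of bisection agree. -/
lemma typeRel_iff_spanRel {f g : PosCone G} :
    TypeRel G f g ↔ SpanRel (sourceMap : G → UnitSpace G) rangeMap f.1 g.1 := by
  have hs : ∀ (E : Set G) (x : UnitSpace G), (sourceMap '' E).indicator (fun _ => (1 : ℤ)) x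
      = (s '' E).indicator (fun _ => (1 : ℤ)) (x : G) := by
    intro E x
    have : (s '' E : Set G) = Subtype.val '' (sourceMap '' E) := by rw [image_image]; rfl
    classical
    rw [indicator_apply, indicator_apply, this, Subtype.val_injective.mem_set_image]
  have hr : ∀ (E : Set G) (x : UnitSpace G), (rangeMap '' E).indicator (fun _ => (1 : ℤ)) x
      = (r '' E).indicator (fun _ => (1 : ℤ)) (x : G) := by
    intro E x
    have : (r '' E : Set G) = Subtype.val '' (rangeMap '' E) := by rw [image_image]; rfl
    classical
    rw [indicator_apply, indicator_apply, this, Subtype.val_injective.mem_set_image]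
  have hE : ∀ E : Set G, IsSpanBisection (sourceMap : G → UnitSpace G) rangeMap E ↔
      IsCompactOpenBisection E := by
    intro E
    constructor
    · intro h
      exact isCompactOpenBisection_of_injOn h.isCompact h.isOpen
        (fun x hx y hy hxy => h.injOn_right hx hy (Subtype.ext hxy))
        (fun x hx y hy hxy => h.injOn_left hx hy (Subtype.ext hxy))
    · intro h
      exact ⟨h.isCompact, h.isOpen, fun x hx y hy hxy => h.injOn_s hx hy (congrArg Subtype.val hxy),
        fun x hx y hy hxy => h.injOn_r hx hy (congrArg Subtype.val hxy)⟩
  simp only [TypeRel, SpanRel, hs, hr, hE]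

lemma exists_isCompact_isOpen_unitSpace [IsAmple G] (x : UnitSpace G) (U : Set (UnitSpace G))
    (hU : U ∈ 𝓝 x) : ∃ V ⊆ U, x ∈ V ∧ IsCompact V ∧ IsOpen V := by
  have h1 : Subtype.val '' U ∈ 𝓝 (x : G) :=
    (isOpen_units (G := G)).isOpenEmbedding_subtypeVal.image_mem_nhds.2 hU
  obtain ⟨E, hE, hxE, hEU⟩ := (IsAmple.isTopologicalBasis (G := G)).mem_nhds_iff.1 h1
  refine ⟨Subtype.val ⁻¹' E, fun y hy => ?_, hxE, ?_, hE.isOpen.preimage continuous_subtype_val⟩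
  · obtain ⟨z, hz, hzy⟩ := hEU hy
    rwa [← Subtype.ext hzy]
  · refine IsInducing.subtypeVal.isCompact_preimage_iff ?_ |>.2 hE.isCompact
    intro y hy
    obtain ⟨z, -, rfl⟩ := hEU hy
    exact ⟨z, rfl⟩

/-- A span with locally injective legs relates every positive function on the left to some positive
function on the right. -/
lemma exists_spanRel [T2Space G] [IsAmple G] {H : Type v} [ArrowGroupoid H] [TopologicalSpace H]
    [T2Space H] {Z : Type w} [TopologicalSpace Z] {p : Z → UnitSpace G} {q : Z → UnitSpace H}
    (hp : Continuous p) (hpo : IsOpenMap p) (hps : Function.Surjective p) (hpi : LocInjective p)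
    (hq : Continuous q) (hqo : IsOpenMap q) (hqi : LocInjective q) (f : PosCone G) :
    ∃ g : PosCone H, SpanRel p q f.1 g.1 := by
  -- Reflexivity serves here only to write `f` as a finite sum of indicators of compact open sets.
  obtain ⟨N, E, hE, hf, -⟩ := typeRel_iff_spanRel.1 (typeRel_refl f)
  have hcov := exists_isSpanBisection hp hpo hpi hqi exists_isCompact_isOpen_unitSpace
  have h1 := fun i => exists_indicator_eq_sum hp hpo hps hcov
    ((hE i).isCompact.image continuous_sourceMap) (isOpenMap_sourceMap _ (hE i).isOpen)
  choose n F hF hsum using h1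
  have hcl : ∀ j : (Σ i, Fin (n i)), IsClopen (q '' F j.1 j.2) := fun j =>
    ⟨((hF _ _).isCompact.image hq).isClosed, hqo _ (hF _ _).isOpen⟩
  -- The partner is obtained by pushing the bisections `F` forward along `q`; their images may
  -- overlap, so multiplicities are counted.
  let g : C_c(UnitSpace H, ℤ) :=
    { toFun := fun y => ∑ j : (Σ i, Fin (n i)), (q '' F j.1 j.2).indicator (fun _ => (1 : ℤ)) y
      continuous_toFun := continuous_finsetSum _ fun j _ =>
        (hcl j).continuous_indicator continuous_const
      hasCompactSupport' := by
        refine HasCompactSupport.intro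
          (isCompact_iUnion fun j : (Σ i, Fin (n i)) => (hF j.1 j.2).isCompact.image hq) ?_
        intro y hy
        exact Finset.sum_eq_zero fun j _ => indicator_of_notMem
          (fun h => hy (mem_iUnion.2 ⟨j, h⟩)) _ }
  refine ⟨⟨g, fun y => Finset.sum_nonneg fun j _ => indicator_nonneg (fun _ _ => zero_le_one) y⟩,
    .of_fintype (fun j : (Σ i, Fin (n i)) => F j.1 j.2) (fun j => hF _ _) (fun x => ?_)
    (fun y => rfl)⟩
  rw [hf x, Fintype.sum_sigma]
  exact Finset.sum_congr rfl fun i _ => hsum i x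

end Etale

end Groupoid

/-! ### Transporters of free and proper actions -/

section Actions

variable {G : Type u} [ArrowGroupoid G] [TopologicalSpace G]
  {H : Type v} [ArrowGroupoid H] [TopologicalSpace H] {Z : Type w} [TopologicalSpace Z]

lemma LeftSpace.act_congr (L : LeftSpace G Z) {g g' : G} {z z' : Z} (h : s g = (L.ρ z : G))
    (h' : s g' = (L.ρ z' : G)) (hg : g = g') (hz : z = z') : L.act g z h = L.act g' z' h' := by
  subst hg hz; rfl

lemma RightSpace.act_congr (R : RightSpace H Z) {h h' : H} {z z' : Z} (k : (R.σ z : H) = r h)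
    (k' : (R.σ z' : H) = r h') (hz : z = z') (hh : h = h') : R.act z h k = R.act z' h' k' := by
  subst hh hz; rfl

/-- If `g · z = g' · z`, then `g'⁻¹ g` fixes `z`, so it is a unit by freeness and `g = g'`. -/
lemma LeftSpace.IsFree.injective {L : LeftSpace G Z} (hL : L.IsFree) {g g' : G} {z : Z}
    (h : s g = (L.ρ z : G)) (h' : s g' = (L.ρ z : G)) (e : L.act g z h = L.act g' z h') :
    g = g' := by
  have hr : r g = r g' := by rw [← L.ρ_act g z h, e, L.ρ_act]
  have hc : s (inv g') = r g := (s_inv g').trans hr.symm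
  refine inv_mul_mem_units hc (hL _ z ((s_mul _ _ _).trans h) ?_)
  have h1 : s (inv g') = (L.ρ (L.act g' z h') : G) := (s_inv g').trans (L.ρ_act g' z h').symm
  calc L.act (mul (inv g') g hc) z _ = L.act (inv g') (L.act g z h) _ := L.mul_act _ _ _ hc h
    _ = L.act (inv g') (L.act g' z h') h1 := L.act_congr _ _ rfl e
    _ = L.act (mul (inv g') g' (s_inv g')) z _ := (L.mul_act _ _ _ (s_inv g') h').symm
    _ = L.act (L.ρ z) z (s_unit _ (L.ρ z).2) := L.act_congr _ _ ((inv_mul g').trans h') rfl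
    _ = z := L.unit_act z

lemma RightSpace.IsFree.injective {R : RightSpace H Z} (hR : R.IsFree) {h h' : H} {z : Z}
    (k : (R.σ z : H) = r h) (k' : (R.σ z : H) = r h') (e : R.act z h k = R.act z h' k') :
    h = h' := by
  have hs : s h = s h' := by rw [← R.σ_act z h k, e, R.σ_act]
  have hc : s h = r (inv h') := hs.trans (r_inv h').symm
  refine mul_mem_units hc (hR z _ (k.trans (r_mul _ _ _).symm) ?_)
  have h1 : (R.σ (R.act z h' k') : H) = r (inv h') := (R.σ_act z h' k').trans (r_inv h').symm
  calc R.act z (mul h (inv h') hc) _ = R.act (R.act z h k) (inv h') _ := R.act_mul _ _ _ k hc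
    _ = R.act (R.act z h' k') (inv h') h1 := R.act_congr _ _ e rfl
    _ = R.act z (mul h' (inv h') (r_inv h').symm) _ := (R.act_mul _ _ _ k' (r_inv h').symm).symm
    _ = R.act z (R.σ z) (r_unit _ (R.σ z).2).symm :=
      R.act_congr _ _ rfl ((mul_inv h').trans k'.symm)
    _ = z := R.act_unit z

/-- Freeness makes `(g, z) ↦ (g · z, z)` injective, and properness makes it closed, hence an
embedding. The transporter is the `G`-coordinate of its inverse, taken at the swapped pair. -/
lemma exists_continuous_left_transporter {L : LeftSpace G Z} (hf : L.IsFree) (hp : L.IsProper)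
    {T : Type*} {q : Z → T}
    (hq : ∀ z z', q z = q z' → ∃ g k, L.act g z k = z') :
    ∃ m : {x : Z × Z // q x.1 = q x.2} → G, Continuous m ∧
      ∀ x, ∃ k, L.act (m x) x.1.1 k = x.1.2 := by
  let Φ : {p : G × Z // s p.1 = (L.ρ p.2 : G)} → Z × Z := fun p => (L.act p.1.1 p.1.2 p.2, p.1.2)
  have hinj : Function.Injective Φ := by
    rintro ⟨⟨g, z⟩, h⟩ ⟨⟨g', z'⟩, h'⟩ e
    obtain rfl : z = z' := congrArg Prod.snd e
    obtain rfl := hf.injective h h' (congrArg Prod.fst e)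
    rfl
  have he : IsClosedEmbedding Φ :=
    .of_continuous_injective_isClosedMap hp.continuous hinj hp.isClosedMap
  let e := he.isEmbedding.toHomeomorph
  have hmem : ∀ x : {x : Z × Z // q x.1 = q x.2}, (x.1.2, x.1.1) ∈ range Φ := fun x => by
    obtain ⟨g, k, hk⟩ := hq _ _ x.2
    exact ⟨⟨(g, x.1.1), k⟩, Prod.ext hk rfl⟩
  refine ⟨fun x => (e.symm ⟨_, hmem x⟩).1.1, ?_, fun x => ?_⟩
  · exact continuous_fst.comp (continuous_subtype_val.comp (e.symm.continuous.comp
      (Continuous.subtype_mk (by fun_prop) _)))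
  · have h1 : Φ (e.symm ⟨_, hmem x⟩) = (x.1.2, x.1.1) :=
      congrArg Subtype.val (e.apply_symm_apply ⟨_, hmem x⟩)
    have h2 : (e.symm ⟨_, hmem x⟩).1.2 = x.1.1 := congrArg Prod.snd h1
    have h3 := (e.symm ⟨_, hmem x⟩).2
    exact ⟨by rw [← h2]; exact h3, (L.act_congr _ h3 rfl h2.symm).trans (congrArg Prod.fst h1)⟩

/-- The argument is that of the left transporter, but the element carries the second point to the
first. This orientation gives it source `σ` of the first point and range `σ` of the second. -/
lemma exists_continuous_right_transporter {R : RightSpace H Z} (hf : R.IsFree) (hp : R.IsProper)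
    {T : Type*} {q : Z → T}
    (hq : ∀ z z', q z = q z' → ∃ h k, R.act z h k = z') :
    ∃ m : {x : Z × Z // q x.1 = q x.2} → H, Continuous m ∧
      ∀ x, ∃ k, R.act x.1.2 (m x) k = x.1.1 := by
  let Φ : {p : Z × H // (R.σ p.1 : H) = r p.2} → Z × Z := fun p => (R.act p.1.1 p.1.2 p.2, p.1.1)
  have hinj : Function.Injective Φ := by
    rintro ⟨⟨z, g⟩, h⟩ ⟨⟨z', g'⟩, h'⟩ e
    obtain rfl : z = z' := congrArg Prod.snd e
    obtain rfl := hf.injective h h' (congrArg Prod.fst e)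
    rfl
  have he : IsClosedEmbedding Φ :=
    .of_continuous_injective_isClosedMap hp.continuous hinj hp.isClosedMap
  let e := he.isEmbedding.toHomeomorph
  have hmem : ∀ x : {x : Z × Z // q x.1 = q x.2}, x.1 ∈ range Φ := fun x => by
    obtain ⟨g, k, hk⟩ := hq _ _ x.2.symm
    exact ⟨⟨(x.1.2, g), k⟩, Prod.ext hk rfl⟩
  refine ⟨fun x => (e.symm ⟨_, hmem x⟩).1.2, ?_, fun x => ?_⟩
  · exact continuous_snd.comp (continuous_subtype_val.comp (e.symm.continuous.comp
      (Continuous.subtype_mk (by fun_prop) _)))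
  · have h1 : Φ (e.symm ⟨_, hmem x⟩) = x.1 :=
      congrArg Subtype.val (e.apply_symm_apply ⟨_, hmem x⟩)
    have h2 : (e.symm ⟨_, hmem x⟩).1.1 = x.1.2 := congrArg Prod.snd h1
    have h3 := (e.symm ⟨_, hmem x⟩).2
    exact ⟨by rw [← h2]; exact h3, (R.act_congr _ h3 h2.symm rfl).trans (congrArg Prod.fst h1)⟩

/-- A map is locally injective if points of the same fibre that are close together are equal. -/
lemma locInjective_of_transporter {T Γ : Type*} [TopologicalSpace Γ] {q : Z → T}
    {m : {x : Z × Z // q x.1 = q x.2} → Γ} (hm : Continuous m) {U : Set Γ} (hU : IsOpen U)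
    (hd : ∀ z, m ⟨(z, z), rfl⟩ ∈ U) (hinj : ∀ x, m x ∈ U → x.1.1 = x.1.2) : LocInjective q := by
  intro z
  obtain ⟨O, hO, hOs⟩ := mem_nhds_subtype _ _ _ |>.1 (hm.continuousAt (hU.mem_nhds (hd z)))
  obtain ⟨V, W, hV, hzV, hW, hzW, hVW⟩ := mem_nhds_prod_iff'.1 hO
  refine ⟨V ∩ W, Filter.inter_mem (hV.mem_nhds hzV) (hW.mem_nhds hzW), fun a ha b hb hab => ?_⟩
  exact hinj ⟨(a, b), hab⟩ (hOs (show (⟨(a, b), hab⟩ : {x : Z × Z // q x.1 = q x.2}) ∈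
    Subtype.val ⁻¹' O from hVW ⟨ha.1, hb.2⟩))

end Actions
-- Passing from a relation to an isomorphism of quotients.
/-- An additive relation that is total on both sides and matches two congruences induces an
isomorphism of the quotients. -/
lemma nonempty_addEquiv_of_rel {M N : Type*} [Add M] [Add N] (c : AddCon M) (d : AddCon N)
    (R : M → N → Prop) (hl : ∀ x, ∃ y, R x y) (hr : ∀ y, ∃ x, R x y)
    (ha : ∀ {x x' y y'}, R x y → R x' y' → R (x + x') (y + y'))
    (hcd : ∀ {x x' y y'}, R x y → R x' y' → (c x x' ↔ d y y')) :
    Nonempty (c.Quotient ≃+ d.Quotient) := by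
  choose φ hφ using hl
  -- The choice `φ` need not be additive; `hcd` makes its class independent of choices, and its two
  -- directions give well-definedness and injectivity.
  let F : c.Quotient → d.Quotient := fun q =>
    AddCon.liftOn q (fun x => (φ x : d.Quotient))
      fun x y h => (AddCon.eq d).2 ((hcd (hφ x) (hφ y)).1 h)
  refine ⟨AddEquiv.ofBijective (⟨F, fun p q => ?_⟩ : AddHom c.Quotient d.Quotient) ⟨?_, ?_⟩⟩
  · induction p, q using AddCon.induction_on₂ with
    | _ x y =>
      exact (AddCon.eq d).2 ((hcd (hφ (x + y)) (ha (hφ x) (hφ y))).1 (c.refl _))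
  · intro p q
    induction p, q using AddCon.induction_on₂ with
    | _ x y => exact fun h => (AddCon.eq c).2 ((hcd (hφ x) (hφ y)).2 ((AddCon.eq d).1 h))
  · intro q
    induction q using AddCon.induction_on with
    | _ y =>
      obtain ⟨x, hx⟩ := hr y
      exact ⟨(x : c.Quotient), (AddCon.eq d).2 ((hcd (hφ x) hx).1 (c.refl x))⟩

/-! ### The correspondence defined by an equivalence space. -/

namespace GroupoidEquivalence

variable {G : Type u} [ArrowGroupoid G] [TopologicalSpace G]
  {H : Type v} [ArrowGroupoid H] [TopologicalSpace H] {Z : Type w} [TopologicalSpace Z]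

/-- Points of a `ρ`-fibre differ by an element of `H`, which is a unit near the diagonal because `H`
has open unit space. -/
lemma locInjective_ρ [IsEtale H] (e : GroupoidEquivalence G H Z) : LocInjective e.left.ρ := by
  obtain ⟨m, hm, hma⟩ := exists_continuous_right_transporter e.right_free e.right_proper e.ρ_fibre
  have hunit : ∀ x, m x ∈ (units : Set H) → x.1.1 = x.1.2 := by
    intro x hx
    obtain ⟨k, hk⟩ := hma x
    rw [← hk]
    refine (e.right.act_congr _ (r_unit _ (e.right.σ x.1.2).2).symm rfl ?_).trans
      (e.right.act_unit _)
    rw [k, r_unit _ hx]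
  refine locInjective_of_transporter hm isOpen_units (fun z => ?_) hunit
  obtain ⟨k, hk⟩ := hma ⟨(z, z), rfl⟩
  exact e.right_free _ _ k hk

lemma locInjective_σ [IsEtale G] (e : GroupoidEquivalence G H Z) : LocInjective e.right.σ := by
  obtain ⟨m, hm, hma⟩ := exists_continuous_left_transporter e.left_free e.left_proper e.σ_fibre
  have hunit : ∀ x, m x ∈ (units : Set G) → x.1.1 = x.1.2 := by
    intro x hx
    obtain ⟨k, hk⟩ := hma x
    rw [← hk]
    refine ((e.left.act_congr _ (s_unit _ (e.left.ρ x.1.1).2) ?_ rfl).trans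
      (e.left.unit_act _)).symm
    rw [← k, s_unit _ hx]
  refine locInjective_of_transporter hm isOpen_units (fun z => ?_) hunit
  obtain ⟨k, hk⟩ := hma ⟨(z, z), rfl⟩
  exact e.left_free _ _ k hk

lemma spanRel_of_left [T2Space G] [IsTopologicalGroupoid G] [IsEtale G] [IsEtale H]
    (e : GroupoidEquivalence G H Z) {f f' : UnitSpace G → ℤ}
    {g : UnitSpace H → ℤ} (h : SpanRel (sourceMap : G → UnitSpace G) rangeMap f f')
    (h' : SpanRel e.left.ρ e.right.σ f' g) : SpanRel e.left.ρ e.right.σ f g := by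
  have hc : ∀ x : {x : G × Z // rangeMap x.1 = e.left.ρ x.2},
      s (inv x.1.1) = (e.left.ρ x.1.2 : G) := fun x => (s_inv _).trans (congrArg Subtype.val x.2)
  -- The pair `(g, z)` satisfies `r g = ρ z`, so `g⁻¹ · z` is defined. It lies over `s g`, as the
  -- left leg requires, and has the same `σ`-value as `z`.
  refine SpanRel.comp (fun x => e.left.act (inv x.1.1) x.1.2 (hc x)) ?_ (fun x => ?_) (fun x => ?_)
    isOpenMap_sourceMap continuous_rangeMap isOpenMap_rangeMap e.left.continuous_ρ
    e.left.isOpenMap_ρ e.left.continuous_ρ e.locInjective_ρ h h'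
  · exact e.left.continuous_act.comp (Continuous.subtype_mk
      (((IsTopologicalGroupoid.continuous_inv (G := G)).comp
        (continuous_fst.comp continuous_subtype_val)).prodMk
        (continuous_snd.comp continuous_subtype_val)) hc)
  · exact Subtype.ext ((e.left.ρ_act _ _ _).trans (r_inv _))
  · exact e.σ_left _ _ _

/-- Here no inverse is needed: `σ z = r h` is exactly the condition for `z · h`, which lies over `s
h`. -/
lemma spanRel_of_right [T2Space H] [IsEtale G] [IsEtale H]
    (e : GroupoidEquivalence G H Z) {f : UnitSpace G → ℤ}
    {g g' : UnitSpace H → ℤ} (h : SpanRel (sourceMap : H → UnitSpace H) rangeMap g g')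
    (h' : SpanRel e.right.σ e.left.ρ g' f) : SpanRel e.right.σ e.left.ρ g f := by
  refine SpanRel.comp
    (fun x => e.right.act x.1.2 x.1.1 (congrArg Subtype.val x.2).symm) ?_ (fun x => ?_)
    (fun x => ?_) isOpenMap_sourceMap continuous_rangeMap isOpenMap_rangeMap e.right.continuous_σ
    e.right.isOpenMap_σ e.right.continuous_σ e.locInjective_σ h h'
  · exact e.right.continuous_act.comp (Continuous.subtype_mk
      ((continuous_snd.comp continuous_subtype_val).prodMk
        (continuous_fst.comp continuous_subtype_val))
      (fun x => (congrArg Subtype.val x.2).symm))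
  · exact Subtype.ext (e.right.σ_act _ _ _)
  · exact e.ρ_right _ _ _

/-- Two copies of `Z` are glued along `ρ`, and the right transporter maps the result to `H`
compatibly with source and range. -/
lemma spanRel_right [T2Space G] [IsEtale H]
    (e : GroupoidEquivalence G H Z) {f : UnitSpace G → ℤ}
    {g g' : UnitSpace H → ℤ} (h : SpanRel e.left.ρ e.right.σ f g)
    (h' : SpanRel e.left.ρ e.right.σ f g') :
    SpanRel (sourceMap : H → UnitSpace H) rangeMap g g' := by
  obtain ⟨m, hm, hma⟩ := exists_continuous_right_transporter e.right_free e.right_proper e.ρ_fibre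
  refine SpanRel.comp m hm (fun x => ?_) (fun x => ?_) e.right.isOpenMap_σ e.left.continuous_ρ
    e.left.isOpenMap_ρ e.left.continuous_ρ e.left.isOpenMap_ρ continuous_sourceMap
    locInjective_sourceMap h.swap h'
  · obtain ⟨k, hk⟩ := hma x
    rw [← hk]
    exact Subtype.ext (e.right.σ_act _ _ _).symm
  · obtain ⟨k, -⟩ := hma x
    exact Subtype.ext k.symm

/-- Dually, gluing along `σ` and using `g` with `g · z = z'` gives `s g = ρ z` and `r g = ρ z'`. -/
lemma spanRel_left [T2Space H] [IsEtale G]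
    (e : GroupoidEquivalence G H Z) {f f' : UnitSpace G → ℤ}
    {g : UnitSpace H → ℤ} (h : SpanRel e.left.ρ e.right.σ f g)
    (h' : SpanRel e.left.ρ e.right.σ f' g) :
    SpanRel (sourceMap : G → UnitSpace G) rangeMap f f' := by
  obtain ⟨m, hm, hma⟩ := exists_continuous_left_transporter e.left_free e.left_proper e.σ_fibre
  refine SpanRel.comp m hm (fun x => ?_) (fun x => ?_) e.left.isOpenMap_ρ e.right.continuous_σ
    e.right.isOpenMap_σ e.right.continuous_σ e.right.isOpenMap_σ continuous_sourceMap
    locInjective_sourceMap h h'.swap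
  · obtain ⟨k, -⟩ := hma x
    exact Subtype.ext k
  · obtain ⟨k, hk⟩ := hma x
    rw [← hk]
    exact Subtype.ext (e.left.ρ_act _ _ _).symm

/-- A groupoid equivalence between ample groupoids induces an isomorphism of type semigroups. -/
theorem nonempty_typeSemigroup_addEquiv [T2Space G] [IsTopologicalGroupoid G] [IsEtale G]
    [IsAmple G] [T2Space H] [IsTopologicalGroupoid H] [IsEtale H] [IsAmple H]
    (e : GroupoidEquivalence G H Z) :
    Nonempty (TypeSemigroup G ≃+ TypeSemigroup H) := by
  refine nonempty_addEquiv_of_rel (typeCon G) (typeCon H)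
    (fun f g => SpanRel e.left.ρ e.right.σ f.1 g.1) (fun f => ?_) (fun g => ?_)
    (fun h h' => h.add h') (fun h h' => ⟨fun k => ?_, fun k => ?_⟩)
  · exact exists_spanRel e.left.continuous_ρ e.left.isOpenMap_ρ e.ρ_surjective e.locInjective_ρ
      e.right.continuous_σ e.right.isOpenMap_σ e.locInjective_σ f
  · obtain ⟨f, hf⟩ := exists_spanRel e.right.continuous_σ e.right.isOpenMap_σ e.σ_surjective
      e.locInjective_σ e.left.continuous_ρ e.left.isOpenMap_ρ e.locInjective_ρ g
    exact ⟨f, hf.swap⟩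
  -- An equivalence on the `G` side is absorbed first, so that both functions on `H⁽⁰⁾` become
  -- partners of one function on `G⁽⁰⁾`. The converse is the same with the legs swapped.
  · exact typeRel_iff_spanRel.2 (e.spanRel_right h (e.spanRel_of_left (typeRel_iff_spanRel.1 k) h'))
  · exact typeRel_iff_spanRel.2
      (e.spanRel_left h (e.spanRel_of_right (typeRel_iff_spanRel.1 k) h'.swap).swap)

end GroupoidEquivalence

end AmpleGpd

theorem mainTheorem8 {G : Type u} {H : Type v}
    [AmpleGpd.ArrowGroupoid G] [TopologicalSpace G] [LocallyCompactSpace G] [T2Space G]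
    [AmpleGpd.IsTopologicalGroupoid G] [AmpleGpd.IsEtale G] [AmpleGpd.IsAmple G]
    [AmpleGpd.ArrowGroupoid H] [TopologicalSpace H] [LocallyCompactSpace H] [T2Space H]
    [AmpleGpd.IsTopologicalGroupoid H] [AmpleGpd.IsEtale H] [AmpleGpd.IsAmple H]
    (hG : IsSigmaCompact (AmpleGpd.ArrowGroupoid.units : Set G))
    (hH : IsSigmaCompact (AmpleGpd.ArrowGroupoid.units : Set H))
    (hGH : AmpleGpd.AreEquivalent.{u, v, w} G H) :
    Nonempty (AmpleGpd.TypeSemigroup G ≃+ AmpleGpd.TypeSemigroup H) := by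
  obtain ⟨Z, _, _, _, ⟨e⟩⟩ := hGH
  exact e.nonempty_typeSemigroup_addEquiv
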